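/- A sequential game consists of a set $A$ of players, a rooted tree $T$ (finite or infinite), a set $O$ of outcomes, an assignment $d$ of a player to each vertex of $T$, a map $v$ from the maximal paths from the root through $T$ (the plays) to $O$, and a preference relation $\prec_a$ on $O$ for each player $a$. The set of plays carries the topology whose basic open sets are the sets of all plays through a given vertex. A strategy profile $s$ chooses an outgoing edge $s(t)$ at every non-leaf vertex $t$; it induces a play, and $s\prec_a s'$ means that $a$ prefers the outcome of the play induced by $s'$ to that of the play induced by $s$. The set of profiles carries the product topology of the discrete sets of outgoing edges. A profile $s$ is a Nash equilibrium if there are no player $a$ and profile $s'$ such that $s\prec_a s'$ and $s(t)=s'(t)$ for all $t$ with $d(t)\ne a$. Write $s\rightharpoonup s'$ (lazy improvement) if for some player $a$ we have $s\prec_a s'$ and every $t$ with $s(t)\neq s'(t)$ satisfies $d(t)=a$ and lies on the play induced by $s'$. For an ordinal $\alpha$, an $\alpha$-sequence of lazy improvement is a family $(s_\beta)_{\beta<\alpha}$ of profiles such that $s_\beta\rightharpoonup s_{\beta+1}$ whenever $\beta+1<\alpha$, and such that for every limit ordinal $\beta<\alpha$, every $\beta'<\beta$ and every neighbourhood $U$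 of $s_\beta$ there is $\gamma$ with $\beta'<\gamma<\beta$ and $s_\gamma\in U$. Corollary. Let $g$ be a sequential game with finite branching and finitely many players who have win/lose objectives, i.e. for every player $a$ there is a set $W_a\subseteq O$ such that $x\prec_a y$ if and only if $x\notin W_a$ and $y\in W_a$. Assume that every winning set $v^{-1}(W_a)$ is $\Delta^0_2$, i.e. both a countable intersection of open sets and a countable union of closed sets. Then every $\alpha$-sequence of lazy improvement in $g$ is countable (that is, $\alpha$ is an at most countable ordinal) and ends at a Nash equilibrium, in the following sense: if an $\alpha$-sequence $(s_\beta)_{\beta<\alpha}$ of lazy improvement cannot be extended to an $(\alpha+1)$-sequence by any choice of $s_\alpha$, then $\alpha=\alpha'+1$ for some $\alpha'$ and $s_{\alpha'}$ is a Nash equilibrium; and every $\alpha$-sequence of lazy improvement is an initial segment of one that has a last term which is a Nash equilibrium. -/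

import Mathlib

/-- `S` is a `Δ⁰₂`-set: a countable intersection of open sets and a countable union of closed
sets. -/
def IsDeltaZeroTwo {X : Type*} [TopologicalSpace X] (S : Set X) : Prop :=
  (∃ U : ℕ → Set X, (∀ i, IsOpen (U i)) ∧ S = ⋂ i, U i) ∧
    (∃ C : ℕ → Set X, (∀ i, IsClosed (C i)) ∧ S = ⋃ i, C i)

/-- `(s β)_{β < α}` is an `α`-sequence of the relation `r` (values of `s` at `β ≥ α` are
irrelevant): successive terms are related by `r`, and at a limit ordinal `β < α` the term `s β`
is an accumulation point of the earlier terms. -/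
def IsOrdinalSequence {S : Type*} [TopologicalSpace S] (r : S → S → Prop)
    (α : Ordinal) (s : Ordinal → S) : Prop :=
  (∀ β, β + 1 < α → r (s β) (s (β + 1))) ∧
    ∀ β < α, Order.IsSuccLimit β →
      ∀ β' < β, ∀ U ∈ nhds (s β), ∃ γ, β' < γ ∧ γ < β ∧ s γ ∈ U

/-- The maximal paths from the root through the tree `T`, as sets of vertices. A vertex is the
list of edge labels on the way from the root to it, and the vertices of a path are pairwise
comparable for the prefix order. -/
def Play {E : Type*} (T : Set (List E)) : Type _ :=
  {p : Set (List E) // Maximal (fun q => q ⊆ T ∧ IsChain (fun t u => t <+: u) q) p}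

/-- The usual topology on the plays: its basic open sets are the sets of all plays through a
given vertex. -/
instance Play.instTopologicalSpace {E : Type*} (T : Set (List E)) : TopologicalSpace (Play T) :=
  TopologicalSpace.generateFrom {C | ∃ t : List E, C = {p : Play T | t ∈ p.1}}

/-- Sequential games with players `A` and outcomes `O`, on a rooted tree (finite or infinite)
with edge labels in `E`. -/
structure SequentialGame (A E O : Type*) where
  /-- The vertices, as a set of lists closed under prefixes, with root `[]`. -/
  tree : Descriptive.tree E
  root_mem : [] ∈ tree
  /-- The player who controls a vertex. -/
  owner : tree → A
  /-- The outcome of a play. -/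
  outcome : Play (tree : Set (List E)) → O
  /-- `pref a x y`: player `a` prefers the outcome `y` to the outcome `x`. -/
  pref : A → O → O → Prop

namespace SequentialGame

variable {A E O : Type*} (G : SequentialGame A E O)

/-- The outgoing edges of a vertex. -/
def edges (t : G.tree) : Set E := {e | t.1 ++ [e] ∈ G.tree}

/-- The tree is finitely branching. -/
def FinitelyBranching : Prop := ∀ t : G.tree, (G.edges t).Finite

/-- The vertices that are not leaves. -/
def Internal : Type _ := {t : G.tree // (G.edges t).Nonempty}

/-- Strategy profiles: a choice of an outgoing edge at every vertex that is not a leaf. The choices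
at the vertices controlled by `a` form the strategy of player `a`. -/
def Profile : Type _ := (t : G.Internal) → G.edges t.1

/-- The product topology on the profiles, each set of outgoing edges being discrete. -/
instance : TopologicalSpace G.Profile :=
  @Pi.topologicalSpace G.Internal (fun t => G.edges t.1) (fun _ => ⊥)

variable {G}

/-- The vertices reached from the root by following the choices of the profile `s`. -/
inductive OnPlay (s : G.Profile) : List E → Prop
  | root : OnPlay s []
  | step (t : G.Internal) : OnPlay s t.1.1 → OnPlay s (t.1.1 ++ [(s t).1])

theorem OnPlay.mem_tree {s : G.Profile} {t : List E} (h : OnPlay s t) : t ∈ G.tree := by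
  cases h with
  | root => exact G.root_mem
  | step t _ => exact (s t).2

theorem OnPlay.isPrefix {s : G.Profile} {t u : List E} (ht : OnPlay s t) (hu : OnPlay s u)
    (h : t.length ≤ u.length) : t <+: u := by
  induction hu generalizing t with
  | root => simp_all
  | step u hu ih =>
    by_cases hl : t.length ≤ u.1.1.length
    · exact (ih ht hl).trans (List.prefix_append _ _)
    · cases ht with
      | root => simp at hl
      | step t ht =>
        simp only [List.length_append, List.length_singleton] at h hl
        have hpre := ih ht (by omega)
        have : t = u := Subtype.ext (Subtype.ext (hpre.eq_of_length (by
          have := hpre.length_le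
          omega)))
        rw [this]

/-- The set of vertices reached by following a profile is a maximal path. -/
theorem maximal_onPlay (s : G.Profile) :
    Maximal (fun q => q ⊆ (G.tree : Set (List E)) ∧ IsChain (fun t u => t <+: u) q)
      {t | OnPlay s t} := by
  refine ⟨⟨fun t ht => ht.mem_tree, fun t ht u hu _ => ?_⟩, fun q hq hle x hx => ?_⟩
  · exact (le_total t.length u.length).imp (ht.isPrefix hu) (hu.isPrefix ht)
  · have key : ∀ n ≤ x.length, OnPlay s (x.take n) := by
      intro n
      induction n with
      | zero => intro _; simpa using OnPlay.root
      | succ n ih =>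
        intro hn
        have hy := ih (by omega)
        have hlen : (x.take n).length = n := by simp; omega
        have hpre : x.take n ++ [x[n]] <+: x := by
          rw [List.take_concat_get' x n (by omega)]
          exact List.take_prefix _ _
        let t : G.Internal := ⟨⟨x.take n, hy.mem_tree⟩, x[n],
          Descriptive.Tree.mem_of_prefix hpre (hq.1 hx)⟩
        have hz : OnPlay s (x.take n ++ [(s t).1]) := OnPlay.step t hy
        have hzx : x.take n ++ [(s t).1] <+: x := by
          by_cases he : x.take n ++ [(s t).1] = x
          · exact ⟨[], by rw [List.append_nil]; exact he⟩
          · rcases hq.2 (hle hz) hx he with h | h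
            · exact h
            · have := h.eq_of_length (by
                have := h.length_le
                simp only [List.length_append, List.length_singleton, hlen] at this ⊢
                omega)
              rw [← this]
        have := List.prefix_iff_eq_take.1 hzx
        simp only [List.length_append, List.length_singleton, hlen] at this
        exact this ▸ hz
    simpa using key x.length le_rfl

/-- The play induced by a profile. -/
def inducedPlay (s : G.Profile) : Play (G.tree : Set (List E)) :=
  ⟨{t | OnPlay s t}, maximal_onPlay s⟩

variable (G)

/-- Player `a` strictly prefers the profile `s'` to `s`. -/
def Prefers (a : A) (s s' : G.Profile) : Prop :=
  G.pref a (G.outcome (inducedPlay s)) (G.outcome (inducedPlay s'))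

/-- Player `a` can convert `s` into `s'`: all strategies of the other players agree. -/
def Converts (a : A) (s s' : G.Profile) : Prop :=
  ∀ t : G.Internal, G.owner t.1 ≠ a → s t = s' t

/-- No player can convert `s` into a profile that she prefers. -/
def IsNashEquilibrium (s : G.Profile) : Prop :=
  ∀ (a : A) (s' : G.Profile), ¬ (G.Prefers a s s' ∧ G.Converts a s s')

/-- Player `a` can lazily convert `s` into `s'`: the profiles differ only at vertices which `a`
controls and which lie along the play induced by `s'`. -/
def LazilyConverts (a : A) (s s' : G.Profile) : Prop :=
  ∀ t : G.Internal, s t ≠ s' t → G.owner t.1 = a ∧ t.1.1 ∈ (inducedPlay s').1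

/-- The collective lazy improvement relation. -/
def LazyImproves (s s' : G.Profile) : Prop :=
  ∃ a : A, G.Prefers a s s' ∧ G.LazilyConverts a s s'

/-- Every player `a` has the win/lose objective to obtain an outcome in `Win a`. -/
def IsWinLose (Win : A → Set O) : Prop :=
  ∀ (a : A) (x y : O), G.pref a x y ↔ x ∉ Win a ∧ y ∈ Win a

/-- The winning set of a player whose winning outcomes are `W`. -/
def winningSet (W : Set O) : Set (Play (G.tree : Set (List E))) :=
  {p | G.outcome p ∈ W}

end SequentialGame

universe z

/-!
The core is that lazy improvement sequences cannot have length `ω₁`. Suppose one does. Finite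
branching makes the tree countable, so there is `β₀ < ω₁` after which only vertices in the set `T` of
cofinally often visited vertices are visited. The profiles whose plays stay in `T` form a closed
subspace of the compact space of profiles. Each winning set is `Δ⁰₂`, so this subspace is covered by
countably many closed sets on each of which no player changes between winning and losing. By the
Baire category theorem one of them has nonempty interior, and since the map from profiles to plays
is open, this yields a vertex `t ∈ T` such that all plays in `T` through `t` are equivalent for
every player (`exists_vertex_constant`).

Consequently, when the play passes through `t` at some time after `β₀`, the next improvement must
leave `t`, and is made by a player who loses on all plays in `T` through `t`. From then on the last
vertex on the way to `t` at which the profile deviates is controlled by such a loser: correcting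
this deviation requires a move by its owner, who has no reason to go to `t` and hence
deviates further down, and vertices beyond the deviation are otherwise untouched because lazy
improvement only acts along the new play (`LastDeviatorIn.lazilyConverts`). The property depends on
finitely many vertices, so it survives limits. Hence `t` is never visited again, contradicting
`t ∈ T` (`not_isOrdinalSequence_omega_one`).

A sequence of limit length can be prolonged by compactness, so one that cannot be extended has a
last term, from which there is no lazy improvement. Such a profile is a Nash equilibrium, because
any improvement can be made lazy (`isNashEquilibrium_of_forall_not_lazyImproves`). Since the lengths
are bounded by `ω₁`, prolonging a sequence as long as possible ends in this situation
(`IsOrdinalSequence.exists_not_extendable`).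
-/

/-! ### Extending ordinal sequences -/

section OrdinalSequence

variable {S : Type*} [TopologicalSpace S] {r : S → S → Prop}

/-- `x` may stand at position `β` after the terms of `s` before `β`: it is an `r`-successor of the
last one if `β` is a successor, and an accumulation point of them if `β` is a limit. -/
def IsNextTerm (r : S → S → Prop) (β : Ordinal.{z}) (s : Ordinal.{z} → S) (x : S) : Prop :=
  (∀ γ, γ + 1 = β → r (s γ) x) ∧
    (Order.IsSuccLimit β → ∀ β' < β, ∀ U ∈ nhds x, ∃ γ, β' < γ ∧ γ < β ∧ s γ ∈ U)

theorem isOrdinalSequence_iff_isNextTerm {α : Ordinal.{z}} {s : Ordinal.{z} → S} :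
    IsOrdinalSequence r α s ↔ ∀ β < α, IsNextTerm r β s (s β) := by
  constructor
  · rintro ⟨h₁, h₂⟩ β hβ
    refine ⟨?_, fun hl => h₂ β hβ hl⟩
    rintro γ rfl
    exact h₁ γ hβ
  · exact fun h => ⟨fun β hβ => (h _ hβ).1 β rfl, fun β hβ hl => (h β hβ).2 hl⟩

theorem IsNextTerm.congr {β : Ordinal.{z}} {s s' : Ordinal.{z} → S} {x : S}
    (h : IsNextTerm r β s x) (hss' : ∀ γ < β, s γ = s' γ) : IsNextTerm r β s' x := by
  refine ⟨fun γ hγ => ?_, fun hl β' hβ' U hU => ?_⟩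
  · rw [← hss' γ (hγ ▸ Order.lt_add_one_iff.2 le_rfl)]
    exact h.1 γ hγ
  · obtain ⟨γ, h₁, h₂, h₃⟩ := h.2 hl β' hβ' U hU
    exact ⟨γ, h₁, h₂, hss' γ h₂ ▸ h₃⟩

theorem IsOrdinalSequence.extend {α : Ordinal.{z}} {s : Ordinal.{z} → S}
    (hs : IsOrdinalSequence r α s) {x : S} (hx : IsNextTerm r α s x) :
    ∃ s' : Ordinal.{z} → S, (∀ β < α, s' β = s β) ∧ IsOrdinalSequence r (α + 1) s' := by
  classical
  have hne : ∀ β < α, Function.update s α x β = s β := fun β hβ =>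
    Function.update_of_ne hβ.ne _ _
  refine ⟨Function.update s α x, hne, isOrdinalSequence_iff_isNextTerm.2 fun β hβ => ?_⟩
  rcases (Order.lt_add_one_iff.1 hβ).lt_or_eq with h | rfl
  · rw [hne β h]
    exact (isOrdinalSequence_iff_isNextTerm.1 hs β h).congr fun γ hγ => (hne γ (hγ.trans h)).symm
  · rw [Function.update_self]
    exact hx.congr fun γ hγ => (hne γ hγ).symm

theorem exists_isNextTerm_of_isSuccLimit [CompactSpace S] {α : Ordinal.{z}}
    (hα : Order.IsSuccLimit α) (s : Ordinal.{z} → S) : ∃ x, IsNextTerm r α s x := by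
  have hpos : 0 < α := hα.bot_lt
  have : Nonempty (Set.Iio α) := ⟨⟨0, hpos⟩⟩
  obtain ⟨x, hx⟩ :=
    exists_clusterPt_of_compactSpace (Filter.map (fun γ : Set.Iio α => s γ) Filter.atTop)
  refine ⟨x, fun γ hγ => ?_, fun _ β' hβ' U hU => ?_⟩
  · have hlt : γ < α := hγ ▸ Order.lt_add_one_iff.2 le_rfl
    exact absurd hγ (hα.add_one_lt hlt).ne
  · obtain ⟨γ, hγ, hU⟩ := (mapClusterPt_iff_frequently.1 hx U hU).forall_exists_of_atTop
      ⟨β' + 1, hα.add_one_lt hβ'⟩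
    exact ⟨γ, Order.add_one_le_iff.1 hγ, γ.2, hU⟩

/-- If the lengths of all ordinal sequences are bounded, then each of them is an initial segment of
one that cannot be extended. -/
theorem IsOrdinalSequence.exists_not_extendable {δ : Ordinal.{z}}
    (hδ : ∀ s : Ordinal.{z} → S, ¬ IsOrdinalSequence r δ s)
    {α : Ordinal.{z}} {s : Ordinal.{z} → S} (hs : IsOrdinalSequence r α s) :
    ∃ (β : Ordinal.{z}) (s' : Ordinal.{z} → S), α ≤ β ∧ (∀ γ < α, s' γ = s γ) ∧
      IsOrdinalSequence r β s' ∧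
      ¬ ∃ s'' : Ordinal.{z} → S, (∀ γ < β, s'' γ = s' γ) ∧ IsOrdinalSequence r (β + 1) s'' := by
  classical
  -- `s'` is `s` before `α`, and picks a next term from `α` on as long as there is one.
  let step : (β : Ordinal.{z}) → ((γ : Ordinal.{z}) → γ < β → S) → S := fun β f =>
    if β < α then s β else
      if h : ∃ x, IsNextTerm r β (fun γ => if hγ : γ < β then f γ hγ else s 0) x
      then h.choose else s 0
  let s' : Ordinal.{z} → S := WellFounded.fix (r := (· < ·)) Ordinal.lt_wf step
  have heq : ∀ β, s' β = step β fun γ _ => s' γ := fun β =>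
    WellFounded.fix_eq (r := (· < ·)) Ordinal.lt_wf step β
  have hlt : ∀ γ < α, s' γ = s γ := fun γ hγ => by rw [heq]; exact if_pos hγ
  have hnext : ∀ β, α ≤ β → (∃ x, IsNextTerm r β s' x) → IsNextTerm r β s' (s' β) := by
    rintro β hβ ⟨x, hx⟩
    have hcongr : ∀ γ < β, s' γ = if hγ : γ < β then s' γ else s 0 :=
      fun γ hγ => (if_pos hγ).symm
    have hex : ∃ x, IsNextTerm r β (fun γ => if hγ : γ < β then s' γ else s 0) x :=
      ⟨x, hx.congr hcongr⟩
    have : s' β = hex.choose := by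
      rw [heq]
      exact (if_neg hβ.not_gt).trans (dif_pos hex)
    rw [this]
    exact hex.choose_spec.congr fun γ hγ => (hcongr γ hγ).symm
  have hα : ∀ β < α, IsNextTerm r β s' (s' β) := fun β hβ => by
    rw [hlt β hβ]
    exact (isOrdinalSequence_iff_isNextTerm.1 hs β hβ).congr
      fun γ hγ => (hlt γ (hγ.trans hβ)).symm
  have hstuck : ∃ β, α ≤ β ∧ ¬ ∃ x, IsNextTerm r β s' x := by
    by_contra! hcon
    refine hδ s' (isOrdinalSequence_iff_isNextTerm.2 fun β _ => ?_)
    rcases lt_or_ge β α with h | h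
    · exact hα β h
    · exact hnext β h (hcon β h)
  obtain ⟨β, ⟨hαβ, hβ⟩, hmin⟩ := WellFounded.has_min (r := (· < ·)) Ordinal.lt_wf
    {β | α ≤ β ∧ ¬ ∃ x, IsNextTerm r β s' x} hstuck
  refine ⟨β, s', hαβ, hlt, isOrdinalSequence_iff_isNextTerm.2 fun γ hγ => ?_, ?_⟩
  · rcases lt_or_ge γ α with h | h
    · exact hα γ h
    · exact hnext γ h (by_contra fun hn => hmin γ ⟨h, hn⟩ hγ)
  · rintro ⟨s'', h₁, h₂⟩
    exact hβ ⟨s'' β, (isOrdinalSequence_iff_isNextTerm.1 h₂ β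
      (Order.lt_add_one_iff.2 le_rfl)).congr h₁⟩

end OrdinalSequence

namespace SequentialGame

variable {A E O : Type*} {G : SequentialGame A E O}

/-! ### Plays and profiles -/

theorem countable_tree (hG : G.FinitelyBranching) : (G.tree : Set (List E)).Countable := by
  have hfin : ∀ n, {t : List E | t ∈ G.tree ∧ t.length = n}.Finite := by
    intro n
    induction n with
    | zero =>
      refine (Set.finite_singleton []).subset ?_
      rintro t ⟨-, ht⟩
      exact List.length_eq_zero_iff.1 ht
    | succ n ih =>
      have : {t : List E | t ∈ G.tree ∧ t.length = n + 1} ⊆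
          ⋃ u ∈ {t : List E | t ∈ G.tree ∧ t.length = n},
            (fun e => u ++ [e]) '' {e | u ++ [e] ∈ G.tree ∧ u ∈ G.tree} := by
        rintro t ⟨ht, hl⟩
        rcases List.eq_nil_or_concat' t with rfl | ⟨u, e, rfl⟩
        · simp at hl
        · have hu : u ∈ G.tree := Descriptive.Tree.mem_of_prefix (List.prefix_append _ _) ht
          exact Set.mem_biUnion (show u ∈ {t : List E | t ∈ G.tree ∧ t.length = n} from
            ⟨hu, by simpa using hl⟩) ⟨e, ⟨ht, hu⟩, rfl⟩
      refine (ih.biUnion fun u hu => ?_).subset this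
      exact ((hG ⟨u, hu.1⟩).subset fun e he => he.1).image _
  have : (G.tree : Set (List E)) = ⋃ n, {t : List E | t ∈ G.tree ∧ t.length = n} := by
    ext t; simp
  rw [this]
  exact Set.countable_iUnion fun n => (hfin n).countable

theorem OnPlay.of_prefix {s : G.Profile} {t u : List E} (h : OnPlay s t) (hu : u <+: t) :
    OnPlay s u := by
  induction h with
  | root => rw [List.prefix_nil.1 hu]; exact .root
  | step t ht ih =>
    rcases List.prefix_concat_iff.1 hu with rfl | h
    · exact .step t ht
    · exact ih h

theorem OnPlay.eq_of_prefix {s : G.Profile} {t : List E} (h : OnPlay s t) {w : G.Internal}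
    {e : E} (hw : w.1.1 ++ [e] <+: t) : (s w).1 = e := by
  have h₁ := OnPlay.step w (h.of_prefix ((List.prefix_append _ _).trans hw))
  have h₂ := h.of_prefix hw
  have := (h₁.isPrefix h₂ (by simp)).eq_of_length (by simp)
  simpa using this

theorem finite_setOf_internal_isPrefix (t : List E) : {w : G.Internal | w.1.1 <+: t}.Finite :=
  Set.Finite.of_injOn (t := {u | u ∈ t.inits}) (f := fun v : G.Internal => v.1.1)
    (fun _ he => (List.mem_inits _ _).2 he)
    (fun _ _ _ _ h => Subtype.ext (Subtype.ext h)) (List.finite_toSet _)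

/-- If the play of `s` does not reach `t`, then there is a last vertex `v` on the way to `t` at which
`s` leaves this way. -/
theorem exists_last_deviation {s : G.Profile} {t : List E} (ht : t ∈ G.tree)
    (hs : ¬ OnPlay s t) :
    ∃ (v : G.Internal) (e : E), v.1.1 ++ [e] <+: t ∧ (s v).1 ≠ e ∧
      ∀ (w : G.Internal) (e' : E), w.1.1 ++ [e'] <+: t → v.1.1.length < w.1.1.length →
        (s w).1 = e' := by
  have hne : {v : G.Internal | ∃ e, v.1.1 ++ [e] <+: t ∧ (s v).1 ≠ e}.Nonempty := by
    by_contra hcon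
    rw [Set.not_nonempty_iff_eq_empty, Set.eq_empty_iff_forall_notMem] at hcon
    refine hs ?_
    clear hs
    induction t using List.reverseRecOn with
    | nil => exact .root
    | append_singleton t e ih =>
      have ht' : t ∈ G.tree := Descriptive.Tree.mem_of_prefix (List.prefix_append _ _) ht
      have h := ih ht' fun w hw => hcon w <| by
        obtain ⟨e', h₁, h₂⟩ := hw
        exact ⟨e', h₁.trans (List.prefix_append _ _), h₂⟩
      by_contra hcon'
      refine hcon ⟨⟨t, ht'⟩, e, ht⟩ ⟨e, List.prefix_rfl, fun he => hcon' ?_⟩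
      have := OnPlay.step ⟨⟨t, ht'⟩, e, ht⟩ h
      rwa [he] at this
  have hfin : {v : G.Internal | ∃ e, v.1.1 ++ [e] <+: t ∧ (s v).1 ≠ e}.Finite :=
    (finite_setOf_internal_isPrefix t).subset fun v ⟨e, he, _⟩ => (List.prefix_append _ _).trans he
  obtain ⟨v, ⟨e, h₁, h₂⟩, hmax⟩ := hfin.exists_maximalFor (fun v => v.1.1.length) _ hne
  refine ⟨v, e, h₁, h₂, fun w e' hw hl => ?_⟩
  by_contra hcon
  exact hl.not_ge (hmax ⟨e', hw, hcon⟩ hl.le)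

/-- A profile that agrees with `s` along the play of `s` induces this play. -/
theorem inducedPlay_eq_of_agree {s x : G.Profile}
    (h : ∀ w : G.Internal, OnPlay s w.1.1 → x w = s w) :
    inducedPlay x = inducedPlay s := by
  have hsub : ∀ t, OnPlay s t → OnPlay x t := by
    intro t ht
    induction ht with
    | root => exact .root
    | step w hw ih => rw [← h w hw]; exact .step w ih
  exact Subtype.ext ((maximal_onPlay s).eq_of_subset (maximal_onPlay x).prop hsub).symm

theorem isOpen_agree (s : G.Profile) (t : List E) :
    IsOpen {x : G.Profile | ∀ w : G.Internal, w.1.1 <+: t → x w = s w} := by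
  let : ∀ w : G.Internal, TopologicalSpace (G.edges w.1) := fun _ => ⊥
  have : ∀ w : G.Internal, DiscreteTopology (G.edges w.1) := fun _ => ⟨rfl⟩
  exact isOpen_set_pi (A := fun w : G.Internal => G.edges w.1) (s := fun w => {s w})
    (finite_setOf_internal_isPrefix t) fun _ _ => isOpen_discrete _

theorem OnPlay.congr {s x : G.Profile} {t : List E} (h : OnPlay s t)
    (hx : ∀ w : G.Internal, w.1.1 <+: t → x w = s w) : OnPlay x t := by
  induction h with
  | root => exact .root
  | step w hw ih =>
    rw [← hx w (List.prefix_append _ _)]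
    exact .step w (ih fun v hv => hx v (hv.trans (List.prefix_append _ _)))

theorem isOpen_onPlay (t : List E) : IsOpen {s : G.Profile | OnPlay s t} :=
  isOpen_iff_mem_nhds.2 fun s hs => Filter.mem_of_superset
    ((isOpen_agree s t).mem_nhds fun _ _ => rfl) fun _ hx => OnPlay.congr hs hx

theorem continuous_inducedPlay : Continuous (inducedPlay : G.Profile → _) := by
  refine continuous_generateFrom_iff.2 ?_
  rintro _ ⟨t, rfl⟩
  exact isOpen_onPlay t

theorem compactSpace_profile (hG : G.FinitelyBranching) : CompactSpace G.Profile := by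
  let : ∀ w : G.Internal, TopologicalSpace (G.edges w.1) := fun _ => ⊥
  have : ∀ w : G.Internal, Finite (G.edges w.1) := fun w => hG w.1
  exact inferInstanceAs (CompactSpace ((w : G.Internal) → G.edges w.1))

theorem t2Space_profile : T2Space G.Profile := by
  let : ∀ w : G.Internal, TopologicalSpace (G.edges w.1) := fun _ => ⊥
  have : ∀ w : G.Internal, DiscreteTopology (G.edges w.1) := fun _ => ⟨rfl⟩
  exact inferInstanceAs (T2Space ((w : G.Internal) → G.edges w.1))

/-- A play is not contained in the path to a vertex that is not a leaf. -/
theorem exists_onPlay_not_prefix (s : G.Profile) (v : G.Internal) :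
    ∃ t, OnPlay s t ∧ ¬ t <+: v.1.1 := by
  by_contra! hcon
  -- otherwise `v` could be added to the play, which is maximal
  have hv : OnPlay s v.1.1 := by
    have hmax := (maximal_onPlay s).eq_of_subset (t := insert v.1.1 {t | OnPlay s t}) ⟨?_, ?_⟩
      (Set.subset_insert _ _)
    · have : v.1.1 ∈ insert v.1.1 {t | OnPlay s t} := Set.mem_insert _ _
      rwa [← hmax] at this
    · exact Set.insert_subset v.1.2 fun t ht => ht.mem_tree
    · exact (maximal_onPlay s).prop.2.insert fun t ht _ => Or.inr (hcon t ht)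
  have := (hcon _ (OnPlay.step v hv)).length_le
  simp at this

/-- The map from profiles to plays is open: the plays through a suitable vertex of the play of `x`
are all induced by profiles in a given neighbourhood of `x`. -/
theorem exists_onPlay_forall_exists_mem {x : G.Profile} {U : Set G.Profile} (hU : U ∈ nhds x) :
    ∃ t, OnPlay x t ∧ ∀ y, OnPlay y t → ∃ y' ∈ U, inducedPlay y' = inducedPlay y := by
  classical
  let : ∀ w : G.Internal, TopologicalSpace (G.edges w.1) := fun _ => ⊥
  have : ∀ w : G.Internal, DiscreteTopology (G.edges w.1) := fun _ => ⟨rfl⟩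
  obtain ⟨V, hVU, hV, hxV⟩ := mem_nhds_iff.1 hU
  obtain ⟨I, u, hu, hIu⟩ := isOpen_pi_iff.1 hV x hxV
  -- a vertex `t` on the play of `x` that lies above none of the vertices in `I`
  have ht : ∃ t, OnPlay x t ∧ ∀ v ∈ I, ¬ t <+: v.1.1 := by
    clear hu hIu
    induction I using Finset.induction_on with
    | empty => exact ⟨[], .root, by simp⟩
    | insert v I _ ih =>
      obtain ⟨t₁, h₁, h₁'⟩ := ih
      obtain ⟨t₂, h₂, h₂'⟩ := exists_onPlay_not_prefix x v
      rcases le_total t₁.length t₂.length with h | h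
      · refine ⟨t₂, h₂, fun w hw hp => ?_⟩
        rcases Finset.mem_insert.1 hw with rfl | hw
        · exact h₂' hp
        · exact h₁' w hw ((h₁.isPrefix h₂ h).trans hp)
      · refine ⟨t₁, h₁, fun w hw hp => ?_⟩
        rcases Finset.mem_insert.1 hw with rfl | hw
        · exact h₂' ((h₂.isPrefix h₁ h).trans hp)
        · exact h₁' w hw hp
  obtain ⟨t, ht, htI⟩ := ht
  -- follow `y` on its play and `x` elsewhere
  refine ⟨t, ht, fun y hy => ⟨fun w => if OnPlay y w.1.1 then y w else x w, hVU (hIu ?_),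
    inducedPlay_eq_of_agree fun w hw => if_pos hw⟩⟩
  intro v hv
  -- if `y` reaches `v`, then so does `x`, and both go on towards `t`
  suffices (if OnPlay y v.1.1 then y v else x v) = x v by
    change (if OnPlay y v.1.1 then y v else x v) ∈ u v
    rw [this]
    exact (hu v hv).2
  split_ifs with hyv
  · have hl : v.1.1.length < t.length := by
      by_contra! h
      exact htI v hv (hy.isPrefix hyv h)
    have hxv := ht.of_prefix (hyv.isPrefix hy hl.le)
    have hstep := (OnPlay.step v hxv).isPrefix ht (by simp; omega)
    exact Subtype.ext (hy.eq_of_prefix hstep)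
  · rfl

/-! ### Winning sets on plays below a vertex -/

/-- A `Δ⁰₂`-set and its complement are covered by countably many closed sets, each of which is
contained in one of the two. -/
theorem _root_.IsDeltaZeroTwo.exists_closed_cover {X : Type*} [TopologicalSpace X] {W : Set X}
    (h : IsDeltaZeroTwo W) :
    ∃ C : ℕ ⊕ ℕ → Set X, (∀ i, IsClosed (C i)) ∧ (∀ i, C i ⊆ W ∨ C i ⊆ Wᶜ) ∧
      ⋃ i, C i = Set.univ := by
  obtain ⟨⟨U, hU, hWU⟩, C, hC, hWC⟩ := h
  refine ⟨Sum.elim C fun i => (U i)ᶜ, ?_, ?_, ?_⟩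
  · rintro (i | i)
    exacts [hC i, (hU i).isClosed_compl]
  · rintro (i | i)
    · exact Or.inl (hWC ▸ Set.subset_iUnion C i)
    · exact Or.inr (Set.compl_subset_compl.2 (hWU ▸ Set.iInter_subset U i))
  · refine Set.eq_univ_of_forall fun x => Set.mem_iUnion.2 ?_
    by_cases hx : x ∈ W
    · rw [hWC] at hx
      obtain ⟨i, hi⟩ := Set.mem_iUnion.1 hx
      exact ⟨.inl i, hi⟩
    · rw [hWU, Set.mem_iInter] at hx
      push Not at hx
      obtain ⟨i, hi⟩ := hx
      exact ⟨.inr i, hi⟩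

/-- By the Baire category theorem, among the profiles whose plays stay in a given set of vertices
there are some that induce plays through a common vertex below which no winning set separates two
such plays. -/
theorem exists_vertex_constant [Finite A] (hG : G.FinitelyBranching) {Win : A → Set O}
    (hΔ : ∀ a : A, IsDeltaZeroTwo (G.winningSet (Win a))) (T : Set (List E)) {x₀ : G.Profile}
    (hx₀ : ∀ u, OnPlay x₀ u → u ∈ T) :
    ∃ t ∈ T, ∀ a, (∀ y : G.Profile, (∀ u, OnPlay y u → u ∈ T) → OnPlay y t →
        G.outcome (inducedPlay y) ∈ Win a) ∨
      (∀ y : G.Profile, (∀ u, OnPlay y u → u ∈ T) → OnPlay y t →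
        G.outcome (inducedPlay y) ∉ Win a) := by
  have := compactSpace_profile hG
  have := t2Space_profile (G := G)
  choose C hC hCW hCU using fun a => (hΔ a).exists_closed_cover
  let K : Set G.Profile := {x | ∀ u, OnPlay x u → u ∈ T}
  have hK : IsClosed K := by
    have : K = ⋂ u, ⋂ (_ : u ∉ T), {x | OnPlay x u}ᶜ := by
      ext x
      simp only [K, Set.mem_ofPred_eq, Set.mem_iInter, Set.mem_compl_iff]
      exact forall_congr' fun u => not_imp_not.symm
    rw [this]
    exact isClosed_iInter fun u => isClosed_iInter fun _ => (isOpen_onPlay u).isClosed_compl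
  have : CompactSpace K := isCompact_iff_compactSpace.1 hK.isCompact
  have : Nonempty K := ⟨⟨x₀, hx₀⟩⟩
  have hcont : Continuous fun x : K => inducedPlay x.1 :=
    continuous_inducedPlay.comp continuous_subtype_val
  -- `i` selects a closed set from the cover for each player
  obtain ⟨i, x, hx⟩ := nonempty_interior_of_iUnion_of_closed
    (f := fun (i : A → ℕ ⊕ ℕ) => {x : K | ∀ a, inducedPlay x.1 ∈ C a (i a)})
    (fun i => by
      simp only [Set.ofPred_forall]
      exact isClosed_iInter fun a => (hC a (i a)).preimage hcont)
    (Set.eq_univ_of_forall fun x => Set.mem_iUnion.2 <| by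
      have : ∀ a, ∃ i, inducedPlay x.1 ∈ C a i := fun a =>
        Set.mem_iUnion.1 (hCU a ▸ Set.mem_univ _)
      exact Classical.skolem.1 this)
  obtain ⟨U, hU, hUi⟩ := mem_nhds_subtype K x _ |>.1 (mem_interior_iff_mem_nhds.1 hx)
  obtain ⟨t, ht, hty⟩ := exists_onPlay_forall_exists_mem hU
  have key : ∀ a, ∀ y : G.Profile, (∀ u, OnPlay y u → u ∈ T) → OnPlay y t →
      inducedPlay y ∈ C a (i a) := by
    intro a y hyT hyt
    obtain ⟨y', hy', he⟩ := hty y hyt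
    have hsame : ∀ u, OnPlay y' u ↔ OnPlay y u := fun u => by
      have := congrArg (fun p => u ∈ p.1) he
      exact iff_of_eq this
    have := hUi (show (⟨y', fun u hu => hyT u ((hsame u).1 hu)⟩ : K) ∈ _ from hy') a
    rwa [he] at this
  refine ⟨t, x.2 t ht, fun a => (hCW a (i a)).imp (fun h y h₁ h₂ => h (key a y h₁ h₂))
    fun h y h₁ h₂ => h (key a y h₁ h₂)⟩

/-! ### Lazy improvement sequences are countable -/

/-- The last vertex on the way to `t` at which the profile `s` leaves this way is controlled by a
player in `L`. -/
def LastDeviatorIn (L : Set A) (t : List E) (s : G.Profile) : Prop :=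
  ∃ (v : G.Internal) (e : E), v.1.1 ++ [e] <+: t ∧ (s v).1 ≠ e ∧ G.owner v.1 ∈ L ∧
    ∀ (w : G.Internal) (e' : E), w.1.1 ++ [e'] <+: t → v.1.1.length < w.1.1.length →
      (s w).1 = e'

theorem LastDeviatorIn.not_onPlay {L : Set A} {t : List E} {s : G.Profile}
    (h : LastDeviatorIn L t s) : ¬ OnPlay s t := by
  obtain ⟨v, e, hv, hne, -⟩ := h
  exact fun ht => hne (ht.eq_of_prefix hv)

theorem LastDeviatorIn.congr {L : Set A} {t : List E} {s x : G.Profile}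
    (h : LastDeviatorIn L t s) (hx : ∀ w : G.Internal, w.1.1 <+: t → s w = x w) :
    LastDeviatorIn L t x := by
  obtain ⟨v, e, hv, hne, hL, hmax⟩ := h
  refine ⟨v, e, hv, ?_, hL, fun w e' hw hl => ?_⟩
  · rwa [← hx v ((List.prefix_append _ _).trans hv)]
  · rw [← hx w ((List.prefix_append _ _).trans hw)]
    exact hmax w e' hw hl

/-- A player who leaves the way to `t` by a lazy conversion is the last deviator afterwards. -/
theorem LazilyConverts.lastDeviatorIn {L : Set A} {t : List E} {s s' : G.Profile} {a : A}
    (h : G.LazilyConverts a s s') (ha : a ∈ L) (ht : OnPlay s t) (ht' : ¬ OnPlay s' t) :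
    LastDeviatorIn L t s' := by
  obtain ⟨v, e, hv, hne, hmax⟩ := exists_last_deviation ht.mem_tree ht'
  refine ⟨v, e, hv, hne, ?_, hmax⟩
  have : s v ≠ s' v := fun he => hne (he ▸ ht.eq_of_prefix hv)
  rwa [(h v this).1]

/-- As long as `t` is not reached by a move of a player in `L`, the last deviator remains in `L`: a
new last deviation behind the old one is made by the player who corrects the old one. -/
theorem LastDeviatorIn.lazilyConverts {L : Set A} {t : List E} {s s' : G.Profile} {a : A}
    (hs : LastDeviatorIn L t s) (h : G.LazilyConverts a s s') (htree : t ∈ G.tree)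
    (ht : OnPlay s' t → a ∉ L) : LastDeviatorIn L t s' := by
  obtain ⟨v, e, hv, hne, hL, hmax⟩ := hs
  have hcorr : (s' v).1 = e → G.owner v.1 = a := fun he =>
    (h v fun heq => hne (heq ▸ he)).1
  by_cases ht' : OnPlay s' t
  · exact absurd (hcorr (ht'.eq_of_prefix hv) ▸ hL) (ht ht')
  obtain ⟨v', e', hv', hne', hmax'⟩ := exists_last_deviation htree ht'
  refine ⟨v', e', hv', hne', ?_, hmax'⟩
  have hpre : ∀ {v v' : G.Internal} {e e' : E}, v.1.1 ++ [e] <+: t → v'.1.1 ++ [e'] <+: t →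
      v.1.1.length < v'.1.1.length → v.1.1 ++ [e] <+: v'.1.1 := fun h₁ h₂ hl =>
    List.prefix_of_prefix_length_le h₁ ((List.prefix_append _ _).trans h₂) (by simp; omega)
  -- the remaining case split compares the last deviation `v'` of `s'` with the one `v` of `s`
  rcases lt_trichotomy v'.1.1.length v.1.1.length with hl | hl | hl
  · -- `v` would be corrected although the new play does not reach it
    have hve := hmax' v e hv hl
    have hon : OnPlay s' v.1.1 := (h v fun heq => hne (heq ▸ hve)).2
    exact absurd (hon.eq_of_prefix (hpre hv' hv hl)) hne'
  · have : v' = v := Subtype.ext <| Subtype.ext <|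
      (List.prefix_of_prefix_length_le ((List.prefix_append _ _).trans hv')
        ((List.prefix_append _ _).trans hv) hl.le).eq_of_length hl
    rwa [this]
  · have hch := h v' fun heq => hne' (heq ▸ hmax v' e' hv' hl)
    have hon : OnPlay s' v'.1.1 := hch.2
    -- both `v` and `v'` were changed, hence by the same player
    rw [hch.1, ← hcorr (hon.eq_of_prefix (hpre hv hv' hl))]
    exact hL

open Ordinal in
/-- The improvement that follows a visit to the vertex of `exists_vertex_constant` prevents all
further visits, so that this vertex is not visited cofinally often. -/
theorem not_isOrdinalSequence_omega_one [Finite A] (hG : G.FinitelyBranching)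
    {Win : A → Set O} (hWin : G.IsWinLose Win)
    (hΔ : ∀ a : A, IsDeltaZeroTwo (G.winningSet (Win a))) (s : Ordinal.{z} → G.Profile) :
    ¬ IsOrdinalSequence G.LazyImproves ω₁ s := by
  intro hs
  have hlim : Order.IsSuccLimit (ω₁ : Ordinal.{z}) := Cardinal.isSuccLimit_omega 1
  -- the vertices that are visited cofinally often
  let T : Set (List E) := {t | ∀ β < (ω₁ : Ordinal.{z}), ∃ γ, β < γ ∧ γ < ω₁ ∧ OnPlay (s γ) t}
  obtain ⟨β₀, hβ₀, hT⟩ : ∃ β₀ < (ω₁ : Ordinal.{z}), ∀ β, β₀ < β → β < ω₁ →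
      ∀ u, OnPlay (s β) u → u ∈ T := by
    have : Countable G.tree := (countable_tree hG).to_subtype
    have : ∀ u : G.tree, ∃ β < (ω₁ : Ordinal.{z}), u.1 ∉ T →
        ∀ γ, β < γ → γ < ω₁ → ¬ OnPlay (s γ) u.1 := by
      intro u
      by_cases hu : u.1 ∈ T
      · exact ⟨0, hlim.bot_lt, fun h => absurd hu h⟩
      · have hu' := hu
        simp only [T, Set.mem_ofPred_eq] at hu'
        push Not at hu'
        obtain ⟨β, h₁, h₂⟩ := hu'
        exact ⟨β, h₁, fun _ => h₂⟩
    choose b hb hbT using this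
    refine ⟨⨆ u, b u, Ordinal.iSup_lt_omega_one hb, fun β h₁ h₂ u hu => ?_⟩
    by_contra hcon
    exact hbT ⟨u, hu.mem_tree⟩ hcon β ((Ordinal.le_iSup _ _).trans_lt h₁) h₂ hu
  obtain ⟨t, htT, hconst⟩ := exists_vertex_constant hG hΔ T (x₀ := s (β₀ + 1))
    (hT _ (Order.lt_add_one_iff.2 le_rfl) (hlim.add_one_lt hβ₀))
  obtain ⟨β, hβ, hβω, hβt⟩ := htT β₀ hβ₀
  -- the players who lose below `t`
  let L : Set A := {a | ∀ y : G.Profile, (∀ u, OnPlay y u → u ∈ T) → OnPlay y t →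
    G.outcome (inducedPlay y) ∉ Win a}
  have hβ1 : β + 1 < ω₁ := hlim.add_one_lt hβω
  have hstart : LastDeviatorIn L t (s (β + 1)) := by
    obtain ⟨a, hpref, hconv⟩ := hs.1 β hβ1
    obtain ⟨hlose, hwin⟩ := (hWin a _ _).1 hpref
    have ha : a ∈ L := (hconst a).resolve_left fun h => hlose (h _ (hT β hβ hβω) hβt)
    refine hconv.lastDeviatorIn ha hβt fun ht => ?_
    exact ha _ (hT _ (hβ.trans (Order.lt_add_one_iff.2 le_rfl)) hβ1) ht hwin
  have hinv : ∀ γ, β + 1 ≤ γ → γ < ω₁ → LastDeviatorIn L t (s γ) := by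
    intro γ
    induction γ using Ordinal.limitRecOn with
    | zero => intro h; simp at h
    | add_one γ ih =>
      intro h hγ
      rcases h.eq_or_lt with h | h
      · rwa [← h]
      have hle : β + 1 ≤ γ := Order.lt_add_one_iff.1 h
      obtain ⟨a, hpref, hconv⟩ := hs.1 γ hγ
      refine (ih hle ((Order.lt_add_one_iff.2 le_rfl).trans hγ)).lazilyConverts hconv
        hβt.mem_tree fun ht ha => ?_
      exact ha _ (hT _ (hβ.trans ((Order.lt_add_one_iff.2 le_rfl).trans h)) hγ) ht
        ((hWin a _ _).1 hpref).2
    | limit γ hγl ih =>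
      intro h hγ
      rcases h.eq_or_lt with h | h
      · rwa [← h]
      obtain ⟨δ, h₁, h₂, h₃⟩ := hs.2 γ hγ hγl _ h _
        ((isOpen_agree (s γ) t).mem_nhds fun _ _ => rfl)
      exact (ih δ h₂ h₁.le (h₂.trans hγ)).congr h₃
  obtain ⟨γ, h₁, h₂, h₃⟩ := htT (β + 1) hβ1
  exact (hinv γ h₁.le h₂).not_onPlay h₃

/-! ### Terminal profiles -/

/-- If a player can improve, then she can improve lazily, by changing her choices only along the
play that she prefers. -/
theorem isNashEquilibrium_of_forall_not_lazyImproves {s : G.Profile}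
    (h : ∀ x, ¬ G.LazyImproves s x) : G.IsNashEquilibrium s := by
  classical
  rintro a s' ⟨hpref, hconv⟩
  let x : G.Profile := fun w => if OnPlay s' w.1.1 then s' w else s w
  have hx : inducedPlay x = inducedPlay s' := inducedPlay_eq_of_agree fun w hw => if_pos hw
  refine h x ⟨a, ?_, fun w hw => ?_⟩
  · rw [Prefers, hx]
    exact hpref
  · have hon : OnPlay s' w.1.1 := by
      by_contra hcon
      exact hw (if_neg hcon).symm
    refine ⟨?_, hx ▸ hon⟩
    by_contra hcon
    exact hw ((hconv w hcon).trans (if_pos hon).symm)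

/-- At limit length there is always a next term, by compactness, so a sequence without one has a last
term that admits no lazy improvement. -/
theorem exists_eq_add_one_isNashEquilibrium (hG : G.FinitelyBranching)
    {α : Ordinal.{z}} {s : Ordinal.{z} → G.Profile} (hs : IsOrdinalSequence G.LazyImproves α s)
    (hext : ¬ ∃ s' : Ordinal.{z} → G.Profile,
      (∀ β < α, s' β = s β) ∧ IsOrdinalSequence G.LazyImproves (α + 1) s') :
    ∃ α' : Ordinal.{z}, α = α' + 1 ∧ G.IsNashEquilibrium (s α') := by
  have := compactSpace_profile hG
  have hnext : ∀ x, ¬ IsNextTerm G.LazyImproves α s x := fun x hx => hext (hs.extend hx)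
  rcases Ordinal.zero_or_succ_or_isSuccLimit α with rfl | ⟨α', rfl⟩ | hl
  · exact absurd ⟨fun γ hγ => absurd hγ (by simp), fun hl => absurd hl (by simp)⟩ (hnext (s 0))
  · refine ⟨α', rfl, isNashEquilibrium_of_forall_not_lazyImproves fun x hx =>
      hnext x ⟨fun γ hγ => ?_, fun hl => absurd rfl (hl.add_one_lt ?_).ne⟩⟩
    · rwa [Order.succ_eq_succ_iff.1 hγ]
    · exact Order.lt_add_one_iff.2 le_rfl
  · obtain ⟨x, hx⟩ := exists_isNextTerm_of_isSuccLimit (r := G.LazyImproves) hl s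
    exact absurd hx (hnext x)

end SequentialGame

theorem mainTheorem6 {A E O : Type*} [Finite A]
    (G : SequentialGame A E O) (hG : G.FinitelyBranching)
    (Win : A → Set O) (hWin : G.IsWinLose Win)
    (hΔ : ∀ a : A, IsDeltaZeroTwo (G.winningSet (Win a)))
    (α : Ordinal.{z}) (s : Ordinal.{z} → G.Profile)
    (hs : IsOrdinalSequence G.LazyImproves α s) :
    -- the sequence is countable
    α.card ≤ Cardinal.aleph0 ∧
    -- if it cannot be extended, then it has a last term, which is a Nash equilibrium
    ((¬ ∃ s' : Ordinal.{z} → G.Profile,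
        (∀ β < α, s' β = s β) ∧ IsOrdinalSequence G.LazyImproves (α + 1) s') →
      ∃ α' : Ordinal.{z}, α = α' + 1 ∧ G.IsNashEquilibrium (s α')) ∧
    -- and it is an initial segment of a sequence whose last term is a Nash equilibrium
    (∃ (α' : Ordinal.{z}) (s' : Ordinal.{z} → G.Profile), α ≤ α' + 1 ∧
      (∀ β < α, s' β = s β) ∧ IsOrdinalSequence G.LazyImproves (α' + 1) s' ∧
      G.IsNashEquilibrium (s' α')) := by
  have hω : ∀ s : Ordinal.{z} → G.Profile, ¬ IsOrdinalSequence G.LazyImproves (Ordinal.omega 1) s :=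
    SequentialGame.not_isOrdinalSequence_omega_one hG hWin hΔ
  refine ⟨?_, SequentialGame.exists_eq_add_one_isNashEquilibrium hG hs, ?_⟩
  · by_contra hcon
    have hle : Ordinal.omega 1 ≤ α := by
      rw [← not_lt, Cardinal.lt_omega_iff_card_lt]
      rw [← Cardinal.succ_aleph0, Order.lt_succ_iff]
      exact hcon
    exact hω s ⟨fun β hβ => hs.1 β (hβ.trans_le hle), fun β hβ => hs.2 β (hβ.trans_le hle)⟩
  · obtain ⟨β, s', hαβ, hagree, hs', hext⟩ := hs.exists_not_extendable hω
    obtain ⟨α', rfl, hnash⟩ := SequentialGame.exists_eq_add_one_isNashEquilibrium hG hs' hext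
    exact ⟨α', s', hαβ, hagree, hs', hnash⟩
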